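/- **Pessimistic feasible sets.** Let $K,d\in\mathbb N$, $\mathbf A\in\mathbb R^{d\times K}$ with rows $\mathbf A^1,\dots,\mathbf A^d$, let $\Delta_K$ be the probability simplex in $\mathbb R^K$, and let $\mathcal F=\{\pi\in\Delta_K:\mathbf A\pi\le \mathbf 0\}$ (inequalities between vectors are componentwise). In each round $s=1,2,\dots$ an arm $\mathbf a_s\in\{e_1,\dots,e_K\}$ (a standard basis vector of $\mathbb R^K$) is chosen by an arbitrary adaptive, possibly randomised strategy, and a cost vector $c_s=\mathbf A\mathbf a_s+\eta_s\in\mathbb R^d$ is observed. For some $R\ge 0$ the noise is conditionally $R$-sub-Gaussian: given the past and $\mathbf a_s$, $\mathbb E[e^{\lambda\eta_s^i}\mid \text{past},\mathbf a_s]\le e^{\lambda^2R^2/2}$ almost surely, for every $\lambda\in\mathbb R$ and $i\in\{1,\dots,d\}$ (in particular, $\eta_s=0$ is allowed). Let $S$ be such that $\|\mathbf A^i\|_2\le S$ for all $i$, and let $v>0$ and $\delta\in(0,1)$. For $t\ge 0$ let $$\Sigma_t=v\mathbf I+\sum_{s=1}^t\mathbf a_s\mathbf a_s^\top,\qquad \hat{\mathbf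 A}_t^i=\Sigma_t^{-1}\sum_{s=1}^t c_s^i\,\mathbf a_s\quad(1\le i\le d)$$ be the Gram matrix and the rows of the regularised least-squares estimate. For a radius $\rho_t\ge 0$, with $\|z\|_{\Sigma}=\sqrt{z^\top\Sigma z}$, let $$\mathcal C_t=\{\mathbf A'\in\mathbb R^{d\times K}:\ \|\mathbf A'^i-\hat{\mathbf A}_t^i\|_{\Sigma_t}\le\rho_t\ \text{ for all } i\},\qquad \hat{\mathcal F}_t=\Big\{\pi\in\Delta_K:\ \min_{\mathbf A'\in\mathcal C_t}\mathbf A'\pi\le\mathbf 0\Big\},$$ where the minimum of the vectors $\mathbf A'\pi\in\mathbb R^d$ is their least element for the componentwise order (it is attained by a single $\mathbf A'\in\mathcal C_t$). 1. If $\rho_t=\sqrt v\,S+R\sqrt{2\log\frac d\delta+\log\frac{\det\Sigma_t}{v^K}}$ for all $t$, then, with probability at least $1-\delta$, $\mathcal F\subseteq\hat{\mathcal F}_t$ for all $t$. 2. If $R\le\frac12$, $\sqrt v\,S\le1$, $v\ge1$ and $d\le K$, the same holds with the radius $\rho_t=f(t,\delta)=1+\sqrt{\frac12\log\frac K\delta+\frac14\log\det\Sigma_t}$.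 (For $d=0$, where $\mathcal C_t$ does not depend on $\rho_t$, any value of $\rho_t$ may be taken.) -/

import Mathlib

open MeasureTheory Matrix

noncomputable section

namespace PessimisticFeasible

/-- The norm `‖z‖_M = √⟨z, M z⟩` of a vector, for a positive semi-definite matrix `M`. -/
def wnorm {K : ℕ} (M : Matrix (Fin K) (Fin K) ℝ) (z : Fin K → ℝ) : ℝ :=
  √(z ⬝ᵥ (M *ᵥ z))

/-- The vector in `ℝ^K` that represents the arm `a`: the `a`-th standard basis vector. -/
def armVec {K : ℕ} (a : Fin K) : Fin K → ℝ := Pi.single a 1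

/-- The regularised Gram matrix `Σ_t = v I + ∑_{s ≤ t} a_s a_sᵀ` of the first `t` rounds.
Rounds are counted from `0`, so that the first `t` rounds are those in `range t`. -/
def gram {K : ℕ} (v : ℝ) (a : ℕ → Fin K) (t : ℕ) : Matrix (Fin K) (Fin K) ℝ :=
  v • (1 : Matrix (Fin K) (Fin K) ℝ) +
    ∑ s ∈ Finset.range t, vecMulVec (armVec (a s)) (armVec (a s))

/-- The regularised least-squares estimate `Â_t`: its `i`-th row is
`Σ_t⁻¹ (∑_{s ≤ t} c_s^i a_s)`, where `c_s` is the cost vector observed in round `s`. -/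
def estimate {K d : ℕ} (v : ℝ) (a : ℕ → Fin K) (c : ℕ → Fin d → ℝ) (t : ℕ) :
    Matrix (Fin d) (Fin K) ℝ :=
  fun i => (gram v a t)⁻¹ *ᵥ ∑ s ∈ Finset.range t, c s i • armVec (a s)

/-- The ellipsoid `C_t` of radius `ρ` around the estimate `Â_t`:
all `A'` with `‖A'^i - Â_t^i‖_{Σ_t} ≤ ρ` for every row `i`. -/
def confSet {K d : ℕ} (v ρ : ℝ) (a : ℕ → Fin K) (c : ℕ → Fin d → ℝ) (t : ℕ) :
    Set (Matrix (Fin d) (Fin K) ℝ) :=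
  {A' | ∀ i, wnorm (gram v a t) (A' i - estimate v a c t i) ≤ ρ}

/-- The true feasible set `F = {π ∈ Δ_K : A π ≤ 0}`. -/
def feasible {K d : ℕ} (A : Matrix (Fin d) (Fin K) ℝ) : Set (Fin K → ℝ) :=
  {π | π ∈ stdSimplex ℝ (Fin K) ∧ A *ᵥ π ≤ 0}

/-- The pessimistic feasible set `{π ∈ Δ_K : min_{A' ∈ C} A' π ≤ 0}` of a set `C` of matrices.
The minimum of the vectors `A' π ∈ ℝ^d` is the least one for the componentwise order, and it is
required to be attained. -/
def pessimistic {K d : ℕ} (C : Set (Matrix (Fin d) (Fin K) ℝ)) : Set (Fin K → ℝ) :=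
  {π | π ∈ stdSimplex ℝ (Fin K) ∧
    ∃ m : Fin d → ℝ, IsLeast ((fun A' : Matrix (Fin d) (Fin K) ℝ => A' *ᵥ π) '' C) m ∧ m ≤ 0}

/-- The confidence radius for cost noise with sub-Gaussian parameter `R` and for constraint rows
of Euclidean norm at most `S`:
`√v S + R √(2 log (d/δ) + log (det Σ_t / det (v I)))`. -/
def radius {K : ℕ} (d : ℕ) (v R S δ : ℝ) (a : ℕ → Fin K) (t : ℕ) : ℝ :=
  √v * S + R * √(2 * Real.log (d / δ) + Real.log ((gram v a t).det / v ^ K))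

/-- The confidence radius `1 + √(½ log (K/δ) + ¼ log det Σ_t)`. -/
def normalizedRadius {K : ℕ} (v δ : ℝ) (a : ℕ → Fin K) (t : ℕ) : ℝ :=
  1 + √(1 / 2 * Real.log (K / δ) + 1 / 4 * Real.log (gram v a t).det)

/-- `X` is sub-Gaussian with parameter `R` conditionally on `m`:
`E[exp (l X) | m] ≤ exp (l² R² / 2)` almost surely, for all real `l`. -/
def CondSubGaussian {Ω : Type*} {mΩ : MeasurableSpace Ω} (P : Measure Ω)
    (m : MeasurableSpace Ω) (R : ℝ) (X : Ω → ℝ) : Prop :=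
  ∀ l : ℝ, Integrable (fun ω => Real.exp (l * X ω)) P ∧
    ∀ᵐ ω ∂P, (P[fun ω' => Real.exp (l * X ω') | m]) ω ≤ Real.exp (l ^ 2 * R ^ 2 / 2)

/-- Cost feedback of a bandit with constraint matrix `A`. `ℱ s` is the information available when
the cost of round `s` is about to be observed: all the past, with any rewards and
randomisation, and the arm of round `s`. The arms are chosen by an arbitrary adaptive and possibly
randomised strategy; the observed cost vector is `A a_s` plus noise which is
sub-Gaussian with parameter `R` in each coordinate, conditionally on `ℱ s`. -/
structure CostFeedback {Ω : Type*} {mΩ : MeasurableSpace Ω} (P : Measure Ω)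
    (ℱ : Filtration ℕ mΩ) {K d : ℕ} (A : Matrix (Fin d) (Fin K) ℝ) (R : ℝ)
    (arm : ℕ → Ω → Fin K) (cost : ℕ → Ω → Fin d → ℝ) : Prop where
  measurable_arm : ∀ s, Measurable[ℱ s] (arm s)
  measurable_cost : ∀ s, Measurable[ℱ (s + 1)] (cost s)
  subGaussian_noise : ∀ s i,
    CondSubGaussian P (ℱ s) R (fun ω => cost s ω i - (A *ᵥ armVec (arm s ω)) i)

end PessimisticFeasible

end

/-! If the true matrix `A` lies in the ellipsoid `C_t`, then the least value of `A' π` over `C_t` is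
at most `A π`, so `F` is contained in the pessimistic set. The whole matter is therefore to keep `A`
in every `C_t` simultaneously with probability at least `1 - δ`.

The arms are basis vectors, so the Gram matrix is diagonal with entries `v + pulls`, and all norms
are weighted sums over coordinates. The error of a row splits into a bias of norm at most `√v S` and
self-normalised noise (`wnorm_sub_estimate_le`).

The noise is controlled by the method of mixtures. For fixed parameters the exponential weight is a
nonnegative supermartingale started at `1` (`lintegral_mul_expWeight_succ_le`), and so is its
average over a Gaussian prior, which has a closed form (`lintegral_expWeight_mixing`). Ville's
inequality at level `d / δ` bounds it at all times at once. Taking logarithms gives the radius, and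
a union bound over the `d` rows gives `δ`. -/

open MeasureTheory Matrix

noncomputable section

namespace PessimisticFeasible

open scoped ENNReal
open ProbabilityTheory

/-! ### Conditional bounds and Ville's inequality -/

/-- A bound on the conditional expectation of `exp ∘ X` may be integrated against nonnegative
weights that are measurable with respect to the conditioning `σ`-algebra. -/
lemma lintegral_mul_exp_le_of_condExp_le {Ω : Type*} {m mΩ : MeasurableSpace Ω} {P : Measure Ω}
    [IsProbabilityMeasure P] (hm : m ≤ mΩ) {X : Ω → ℝ} {c : ℝ}
    (hX : Measurable X) (hint : Integrable (fun ω => Real.exp (X ω)) P)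
    (hle : ∀ᵐ ω ∂P, (P[fun ω' => Real.exp (X ω') | m]) ω ≤ c) {W : Ω → ℝ≥0∞}
    (hW : Measurable[m] W) :
    ∫⁻ ω, W ω * ENNReal.ofReal (Real.exp (X ω)) ∂P ≤ ENNReal.ofReal c * ∫⁻ ω, W ω ∂P := by
  set f : Ω → ℝ≥0∞ := fun ω => ENNReal.ofReal (Real.exp (X ω)) with hf
  have hfm : Measurable f := hX.exp.ennreal_ofReal
  -- On `m`-measurable events the conditional bound is an inequality of measures; it then passes to
  -- every `m`-measurable weight `W`, with no integrability needed.
  have key : (P.withDensity f).trim hm ≤ (ENNReal.ofReal c • P).trim hm := by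
    refine Measure.le_iff.2 fun s hs => ?_
    rw [trim_measurableSet_eq hm hs, trim_measurableSet_eq hm hs, withDensity_apply _ (hm s hs),
      Measure.smul_apply, smul_eq_mul, hf,
      ← ofReal_integral_eq_lintegral_ofReal hint.integrableOn
        (Filter.Eventually.of_forall fun ω => (Real.exp_pos _).le),
      ← setIntegral_condExp hm hint hs]
    have hc : ∫ ω in s, (P[fun ω' => Real.exp (X ω') | m]) ω ∂P ≤ ∫ _ω in s, c ∂P :=
      integral_mono_ae integrable_condExp.integrableOn (integrable_const c)
        (ae_restrict_of_ae hle)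
    refine (ENNReal.ofReal_le_ofReal hc).trans ?_
    rw [setIntegral_const, smul_eq_mul, ENNReal.ofReal_mul measureReal_nonneg,
      ofReal_measureReal, mul_comm]
  calc ∫⁻ ω, W ω * f ω ∂P = ∫⁻ ω, W ω ∂(P.withDensity f) := by
        rw [lintegral_withDensity_eq_lintegral_mul _ hfm (hW.mono hm le_rfl)]
        simp [mul_comm]
    _ = ∫⁻ ω, W ω ∂((P.withDensity f).trim hm) := (lintegral_trim hm hW).symm
    _ ≤ ∫⁻ ω, W ω ∂((ENNReal.ofReal c • P).trim hm) := lintegral_mono' key le_rfl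
    _ = ∫⁻ ω, W ω ∂(ENNReal.ofReal c • P) := lintegral_trim hm hW
    _ = ENNReal.ofReal c * ∫⁻ ω, W ω ∂P := by rw [lintegral_smul_measure, smul_eq_mul]

/-- Ville's maximal inequality for a nonnegative process whose integral over each event of the past
does not increase. -/
lemma measure_exists_le_of_setLIntegral_succ_le {Ω : Type*} {mΩ : MeasurableSpace Ω}
    {P : Measure Ω} (ℱ : Filtration ℕ mΩ) {M : ℕ → Ω → ℝ≥0∞}
    (hM : ∀ t, Measurable[ℱ t] (M t))
    (hstep : ∀ t s, MeasurableSet[ℱ t] s → ∫⁻ ω in s, M (t + 1) ω ∂P ≤ ∫⁻ ω in s, M t ω ∂P)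
    (c : ℝ≥0∞) :
    c * P {ω | ∃ t, c ≤ M t ω} ≤ ∫⁻ ω, M 0 ω ∂P := by
  set H : ℕ → Set Ω := fun n => {ω | ∃ t < n, c ≤ M t ω} with hH
  -- `H (t + 1)` involves only times up to `t`, so its complement is an event to which `hstep t`
  -- applies.
  have hHm : ∀ t, MeasurableSet[ℱ t] (H (t + 1)) := by
    intro t
    have : H (t + 1) = ⋃ s ∈ Finset.range (t + 1), {ω | c ≤ M s ω} := by
      ext ω; simp [hH]
    rw [this]
    refine Finset.measurableSet_biUnion _ fun s hs => ?_
    have hst : s ≤ t := Nat.lt_succ_iff.1 (Finset.mem_range.1 hs)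
    exact ℱ.mono hst _ (measurableSet_le (@measurable_const _ _ _ (ℱ s) c) (hM s))
  have hHm' : ∀ t, MeasurableSet (H t) := by
    intro t
    cases t with
    | zero => simp [hH]
    | succ t => exact ℱ.le t _ (hHm t)
  have hMm : ∀ t, Measurable (M t) := fun t => (hM t).mono (ℱ.le t) le_rfl
  -- This is the process stopped on first reaching `c`: paths already caught are counted at the
  -- value `c`, the others at their current value.
  have hmain : ∀ n, c * P (H n) + ∫⁻ ω in (H n)ᶜ, M n ω ∂P ≤ ∫⁻ ω, M 0 ω ∂P := by
    intro n
    induction n with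
    | zero => simp [hH]
    | succ n ih =>
      refine le_trans ?_ ih
      set D : Set Ω := (H n)ᶜ ∩ {ω | c ≤ M n ω} with hD
      have hDm : MeasurableSet D :=
        (hHm' n).compl.inter (measurableSet_le measurable_const (hMm n))
      have hHs : H (n + 1) = H n ∪ D := by
        ext ω
        simp only [hH, hD, Set.mem_ofPred_eq, Set.mem_union, Set.mem_inter_iff, Set.mem_compl_iff]
        constructor
        · rintro ⟨t, ht, h⟩
          by_cases hn : ∃ t < n, c ≤ M t ω
          · exact Or.inl hn
          · refine Or.inr ⟨hn, ?_⟩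
            rcases Nat.lt_succ_iff_lt_or_eq.1 ht with h' | rfl
            · exact absurd ⟨t, h', h⟩ hn
            · exact h
        · rintro (⟨t, ht, h⟩ | ⟨-, h⟩)
          · exact ⟨t, by omega, h⟩
          · exact ⟨n, by omega, h⟩
      have hcompl : (H n)ᶜ = D ∪ (H (n + 1))ᶜ := by
        rw [hHs]
        ext ω
        simp only [hD, Set.mem_union, Set.mem_inter_iff, Set.mem_compl_iff]
        tauto
      have hdisj : Disjoint D (H (n + 1))ᶜ := by
        rw [hHs]
        exact Set.disjoint_compl_right_iff_subset.2 Set.subset_union_right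
      have h1 : P (H (n + 1)) ≤ P (H n) + P D := by rw [hHs]; exact measure_union_le _ _
      have h2 : c * P D ≤ ∫⁻ ω in D, M n ω ∂P := by
        rw [← setLIntegral_const]
        exact setLIntegral_mono (hMm n) fun ω hω => hω.2
      have h3 := hstep n _ (hHm n).compl
      calc c * P (H (n + 1)) + ∫⁻ ω in (H (n + 1))ᶜ, M (n + 1) ω ∂P
          ≤ c * (P (H n) + P D) + ∫⁻ ω in (H (n + 1))ᶜ, M n ω ∂P := by gcongr
        _ ≤ c * P (H n) + (∫⁻ ω in D, M n ω ∂P + ∫⁻ ω in (H (n + 1))ᶜ, M n ω ∂P) := by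
            rw [mul_add, add_assoc]; gcongr
        _ = c * P (H n) + ∫⁻ ω in (H n)ᶜ, M n ω ∂P := by
            rw [← lintegral_union (hHm' _).compl hdisj, ← hcompl]
  have hU : {ω | ∃ t, c ≤ M t ω} = ⋃ n, H n := by
    ext ω
    simp only [hH, Set.mem_ofPred_eq, Set.mem_iUnion]
    exact ⟨fun ⟨t, h⟩ => ⟨t + 1, t, by omega, h⟩, fun ⟨_, t, _, h⟩ => ⟨t, h⟩⟩
  have hmono : Monotone H := fun a b hab ω ⟨t, ht, h⟩ => ⟨t, lt_of_lt_of_le ht hab, h⟩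
  rw [hU, hmono.measure_iUnion, ENNReal.mul_iSup]
  exact iSup_le fun n => le_self_add.trans (hmain n)

/-! ### Exponential weights and their mixtures -/

/-- The number of the first `t` rounds in which arm `k` is played. -/
def pulls {K : ℕ} (a : ℕ → Fin K) (t : ℕ) (k : Fin K) : ℝ :=
  ∑ s ∈ Finset.range t, if a s = k then 1 else 0

/-- The sum of the values `x s` over those of the first `t` rounds in which arm `k` is played. -/
def armSum {K : ℕ} (a : ℕ → Fin K) (x : ℕ → ℝ) (t : ℕ) (k : Fin K) : ℝ :=
  ∑ s ∈ Finset.range t, if a s = k then x s else 0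

lemma pulls_nonneg {K : ℕ} (a : ℕ → Fin K) (t : ℕ) (k : Fin K) : 0 ≤ pulls a t k :=
  Finset.sum_nonneg fun _ _ => by split_ifs <;> norm_num

/-- The exponential weight with one parameter `l k` for each arm `k`. -/
def expWeight {K : ℕ} (R : ℝ) (l : Fin K → ℝ) (a : ℕ → Fin K) (x : ℕ → ℝ) (t : ℕ) : ℝ≥0∞ :=
  ∏ k, ENNReal.ofReal (Real.exp (l k * armSum a x t k - l k ^ 2 * R ^ 2 * pulls a t k / 2))

/-- Only the factor of the arm played in round `t` changes. -/
lemma expWeight_succ {K : ℕ} (R : ℝ) (l : Fin K → ℝ) (a : ℕ → Fin K) (x : ℕ → ℝ) (t : ℕ) :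
    expWeight R l a x (t + 1) = expWeight R l a x t *
      ENNReal.ofReal (Real.exp (l (a t) * x t - l (a t) ^ 2 * R ^ 2 / 2)) := by
  have h : ENNReal.ofReal (Real.exp (l (a t) * x t - l (a t) ^ 2 * R ^ 2 / 2)) =
      ∏ k, if a t = k then ENNReal.ofReal (Real.exp (l k * x t - l k ^ 2 * R ^ 2 / 2)) else 1 := by
    simp
  rw [h, expWeight, expWeight, ← Finset.prod_mul_distrib]
  refine Finset.prod_congr rfl fun k _ => ?_
  simp only [armSum, pulls, Finset.sum_range_succ]
  split_ifs with hk
  · rw [← ENNReal.ofReal_mul (Real.exp_pos _).le, ← Real.exp_add]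
    congr 2
    ring
  · simp

section Mixture

variable {Ω : Type*} {mΩ : MeasurableSpace Ω} {P : Measure Ω} [IsProbabilityMeasure P]
  {ℱ : Filtration ℕ mΩ} {K : ℕ} {arm : ℕ → Ω → Fin K} {X : ℕ → Ω → ℝ} {R : ℝ}

lemma measurable_pulls (harm : ∀ s, Measurable[ℱ s] (arm s)) (t : ℕ) (k : Fin K) :
    Measurable[ℱ t] fun ω => pulls (fun s => arm s ω) t k := by
  unfold pulls
  refine Finset.measurable_fun_sum _ fun s hs => ?_
  have hst : s ≤ t := (Finset.mem_range.1 hs).le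
  exact Measurable.ite (ℱ.mono hst _ (harm s (measurableSet_singleton k))) measurable_const
    measurable_const

lemma measurable_armSum (harm : ∀ s, Measurable[ℱ s] (arm s))
    (hX : ∀ s, Measurable[ℱ (s + 1)] (X s)) (t : ℕ) (k : Fin K) :
    Measurable[ℱ t] fun ω => armSum (fun s => arm s ω) (fun s => X s ω) t k := by
  unfold armSum
  refine Finset.measurable_fun_sum _ fun s hs => ?_
  have hst : s + 1 ≤ t := Finset.mem_range.1 hs
  exact Measurable.ite (ℱ.mono ((Nat.le_succ s).trans hst) _ (harm s (measurableSet_singleton k)))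
    ((hX s).mono (ℱ.mono hst) le_rfl) measurable_const

lemma measurable_expWeight (harm : ∀ s, Measurable[ℱ s] (arm s))
    (hX : ∀ s, Measurable[ℱ (s + 1)] (X s)) (l : Fin K → ℝ) (t : ℕ) :
    Measurable[ℱ t] fun ω => expWeight R l (fun s => arm s ω) (fun s => X s ω) t := by
  have h1 := measurable_armSum harm hX t
  have h2 := measurable_pulls harm t
  let _ : MeasurableSpace Ω := ℱ t
  unfold expWeight
  refine Finset.measurable_fun_prod _ fun k _ => ?_
  have h1 := h1 k
  have h2 := h2 k
  fun_prop

lemma measurable_expWeight_prod (harm : ∀ s, Measurable[ℱ s] (arm s))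
    (hX : ∀ s, Measurable[ℱ (s + 1)] (X s)) (t : ℕ) :
    Measurable[(ℱ t).prod MeasurableSpace.pi] fun p : Ω × (Fin K → ℝ) =>
      expWeight R p.2 (fun s => arm s p.1) (fun s => X s p.1) t := by
  let _ : MeasurableSpace Ω := ℱ t
  unfold expWeight
  refine Finset.measurable_fun_prod _ fun k _ => ?_
  have h1 : Measurable fun p : Ω × (Fin K → ℝ) =>
      armSum (fun s => arm s p.1) (fun s => X s p.1) t k :=
    (measurable_armSum harm hX t k).comp measurable_fst
  have h2 : Measurable fun p : Ω × (Fin K → ℝ) => pulls (fun s => arm s p.1) t k :=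
    (measurable_pulls harm t k).comp measurable_fst
  fun_prop

/-- The supermartingale property. The parameter `l (arm t ω)` of the new factor is random, while the
sub-Gaussian bound is for fixed parameters. The event is therefore split according to the arm, which
is known to `ℱ t`; on each piece the parameter is constant. -/
lemma lintegral_mul_expWeight_succ_le (harm : ∀ s, Measurable[ℱ s] (arm s))
    (hX : ∀ s, Measurable[ℱ (s + 1)] (X s)) (hsub : ∀ s, CondSubGaussian P (ℱ s) R (X s))
    (l : Fin K → ℝ) (t : ℕ) {s : Set Ω} (hs : MeasurableSet[ℱ t] s) :
    ∫⁻ ω in s, expWeight R l (fun s => arm s ω) (fun s => X s ω) (t + 1) ∂P ≤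
      ∫⁻ ω in s, expWeight R l (fun s => arm s ω) (fun s => X s ω) t ∂P := by
  set E : ℕ → Ω → ℝ≥0∞ := fun t ω => expWeight R l (fun s => arm s ω) (fun s => X s ω) t with hE
  have hEm : Measurable[ℱ t] (E t) := measurable_expWeight harm hX l t
  have hXm : Measurable (X t) := (hX t).mono (ℱ.le _) le_rfl
  have hEm' : Measurable (E t) := hEm.mono (ℱ.le t) le_rfl
  set B : Fin K → Set Ω := fun k => s ∩ {ω | arm t ω = k} with hB
  have hBm : ∀ k, MeasurableSet[ℱ t] (B k) := fun k =>
    hs.inter (harm t (measurableSet_singleton k))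
  have hunion : s = ⋃ k, B k := by ext ω; simp [hB]
  have hdisj : Pairwise (Function.onFun Disjoint B) := by
    intro j k hjk
    refine Set.disjoint_left.2 fun ω h1 h2 => hjk ?_
    exact h1.2.symm.trans h2.2
  rw [hunion, lintegral_iUnion (fun k => ℱ.le t _ (hBm k)) hdisj,
    lintegral_iUnion (fun k => ℱ.le t _ (hBm k)) hdisj]
  refine ENNReal.tsum_le_tsum fun k => ?_
  have hW : Measurable[ℱ t] ((B k).indicator (E t)) := hEm.indicator (hBm k)
  have h := lintegral_mul_exp_le_of_condExp_le (ℱ.le t) (hXm.const_mul (l k)) (hsub t (l k)).1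
    (hsub t (l k)).2 hW
  rw [lintegral_indicator (ℱ.le t _ (hBm k))] at h
  set q : ℝ := l k ^ 2 * R ^ 2 / 2 with hq
  calc ∫⁻ ω in B k, E (t + 1) ω ∂P
      = ∫⁻ ω, ENNReal.ofReal (Real.exp (-q)) *
          ((B k).indicator (E t) ω * ENNReal.ofReal (Real.exp (l k * X t ω))) ∂P := by
        rw [← lintegral_indicator (ℱ.le t _ (hBm k))]
        refine lintegral_congr fun ω => ?_
        by_cases hω : ω ∈ B k
        · have hk : arm t ω = k := hω.2
          rw [Set.indicator_of_mem hω, Set.indicator_of_mem hω]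
          simp only [hE]
          rw [expWeight_succ, hk, mul_left_comm, ← ENNReal.ofReal_mul (Real.exp_pos _).le,
            ← Real.exp_add, hq]
          congr 3
          ring
        · simp [hω]
    _ = ENNReal.ofReal (Real.exp (-q)) * ∫⁻ ω,
          ((B k).indicator (E t) ω * ENNReal.ofReal (Real.exp (l k * X t ω))) ∂P := by
        rw [lintegral_const_mul' _ _ ENNReal.ofReal_ne_top]
    _ ≤ ENNReal.ofReal (Real.exp (-q)) *
          (ENNReal.ofReal (Real.exp q) * ∫⁻ ω in B k, E t ω ∂P) := by gcongr
    _ = ∫⁻ ω in B k, E t ω ∂P := by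
        rw [← mul_assoc, ← ENNReal.ofReal_mul (Real.exp_pos _).le, ← Real.exp_add]
        simp

/-- The method of mixtures: a mixture of exponential weights exceeds `c` at some time with
probability at most `1 / c`. -/
lemma measure_exists_le_mixture (harm : ∀ s, Measurable[ℱ s] (arm s))
    (hX : ∀ s, Measurable[ℱ (s + 1)] (X s)) (hsub : ∀ s, CondSubGaussian P (ℱ s) R (X s))
    (ν : Measure (Fin K → ℝ)) [IsProbabilityMeasure ν] (c : ℝ≥0∞) :
    c * P {ω | ∃ t, c ≤ ∫⁻ l, expWeight R l (fun s => arm s ω) (fun s => X s ω) t ∂ν} ≤ 1 := by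
  have hmeas : ∀ t, Measurable (fun p : Ω × (Fin K → ℝ) =>
      expWeight R p.2 (fun s => arm s p.1) (fun s => X s p.1) t) := fun t =>
    (measurable_expWeight_prod harm hX t).mono
      (sup_le_sup (MeasurableSpace.comap_mono (ℱ.le t)) le_rfl) le_rfl
  refine (measure_exists_le_of_setLIntegral_succ_le ℱ (P := P) (M := fun t ω =>
    ∫⁻ l, expWeight R l (fun s => arm s ω) (fun s => X s ω) t ∂ν) ?_ ?_ c).trans ?_
  · intro t
    let _ : MeasurableSpace Ω := ℱ t
    exact (measurable_expWeight_prod harm hX t).lintegral_prod_right'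
  · intro t s hs
    have hswap : ∀ t, ∫⁻ ω in s, ∫⁻ l, expWeight R l (fun s => arm s ω) (fun s => X s ω) t ∂ν ∂P =
        ∫⁻ l, ∫⁻ ω in s, expWeight R l (fun s => arm s ω) (fun s => X s ω) t ∂P ∂ν := fun t =>
      lintegral_lintegral_swap (hmeas t).aemeasurable
    rw [hswap, hswap]
    exact lintegral_mono fun l => lintegral_mul_expWeight_succ_le harm hX hsub l t hs
  · simp [expWeight, armSum, pulls]

end Mixture

/-! ### Gaussian integration and the diagonal Gram matrix -/

/-- Completing the square: a prior of precision `b` times the weight is a multiple of the Gaussian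
density of mean `x / (b + c)` and precision `b + c`. -/
lemma lintegral_exp_gaussianReal {b c : ℝ} (hb : 0 < b) (hc : 0 ≤ c) (x : ℝ) :
    ∫⁻ l, ENNReal.ofReal (Real.exp (l * x - l ^ 2 * c / 2))
        ∂(gaussianReal 0 (Real.toNNReal b⁻¹)) =
      ENNReal.ofReal (√(b / (b + c)) * Real.exp (x ^ 2 / (2 * (b + c)))) := by
  have hbc : 0 < b + c := by linarith
  have h1 : Real.toNNReal b⁻¹ ≠ 0 := by simpa using hb
  have h2 : Real.toNNReal (b + c)⁻¹ ≠ 0 := by simpa using hbc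
  have hsqrt : (√(2 * Real.pi * b⁻¹))⁻¹ = √(b / (b + c)) * (√(2 * Real.pi * (b + c)⁻¹))⁻¹ := by
    rw [← Real.sqrt_inv, ← Real.sqrt_inv, ← Real.sqrt_mul (by positivity)]
    congr 1
    field_simp
  rw [gaussianReal_of_var_ne_zero _ h1, lintegral_withDensity_eq_lintegral_mul _
    (measurable_gaussianPDF _ _) (by fun_prop)]
  calc _ = ∫⁻ l, ENNReal.ofReal (√(b / (b + c)) * Real.exp (x ^ 2 / (2 * (b + c)))) *
        gaussianPDF (x / (b + c)) (Real.toNNReal (b + c)⁻¹) l := by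
        refine lintegral_congr fun l => ?_
        rw [Pi.mul_apply, gaussianPDF, gaussianPDF,
          ← ENNReal.ofReal_mul (gaussianPDFReal_nonneg _ _ _), ← ENNReal.ofReal_mul (by positivity),
          gaussianPDFReal, gaussianPDFReal, Real.coe_toNNReal _ (by positivity),
          Real.coe_toNNReal _ (by positivity), hsqrt]
        congr 1
        have hexp : Real.exp (-(l - 0) ^ 2 / (2 * b⁻¹)) * Real.exp (l * x - l ^ 2 * c / 2) =
            Real.exp (x ^ 2 / (2 * (b + c))) *
              Real.exp (-(l - x / (b + c)) ^ 2 / (2 * (b + c)⁻¹)) := by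
          rw [← Real.exp_add, ← Real.exp_add]
          congr 1
          field_simp
          ring
        linear_combination √(b / (b + c)) * (√(2 * Real.pi * (b + c)⁻¹))⁻¹ * hexp
    _ = _ := by
        rw [lintegral_const_mul' _ _ ENNReal.ofReal_ne_top, lintegral_gaussianPDF_eq_one _ h2,
          mul_one]

lemma gram_eq_diagonal {K : ℕ} (v : ℝ) (a : ℕ → Fin K) (t : ℕ) :
    gram v a t = diagonal fun k => v + pulls a t k := by
  ext i j
  simp only [gram, armVec, pulls, Matrix.add_apply, Matrix.smul_apply, Matrix.one_apply,
    Matrix.sum_apply, vecMulVec_apply, Pi.single_apply, diagonal_apply, smul_eq_mul]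
  by_cases h : i = j
  · subst h
    simp only [if_true, mul_one, mul_ite, mul_zero, add_right_inj]
    refine Finset.sum_congr rfl fun s _ => ?_
    simp only [eq_comm (a := a s)]
    split_ifs <;> rfl
  · simp only [h, if_false, mul_zero, zero_add]
    refine Finset.sum_eq_zero fun s _ => ?_
    by_cases hi : i = a s
    · simp [← hi, Ne.symm h]
    · simp [hi]

lemma det_gram {K : ℕ} (v : ℝ) (a : ℕ → Fin K) (t : ℕ) :
    (gram v a t).det = ∏ k, (v + pulls a t k) := by
  rw [gram_eq_diagonal, det_diagonal]

/-- The squared norm `‖∑ x_s a_s‖²` for the inverse of the Gram matrix. -/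
def invGramSq {K : ℕ} (v : ℝ) (a : ℕ → Fin K) (x : ℕ → ℝ) (t : ℕ) : ℝ :=
  ∑ k, armSum a x t k ^ 2 / (v + pulls a t k)

/-- The Gaussian mixing distribution on the parameters of the exponential weights. -/
def mixing (K : ℕ) (v R : ℝ) : Measure (Fin K → ℝ) :=
  Measure.pi fun _ => gaussianReal 0 (Real.toNNReal (R ^ 2 * v)⁻¹)

instance (K : ℕ) (v R : ℝ) : IsProbabilityMeasure (mixing K v R) := by
  unfold mixing; infer_instance

/-- Both the weight and the prior are products over the arms, so the integral is a product of
one-dimensional Gaussian integrals. -/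
lemma lintegral_expWeight_mixing {K : ℕ} {v R : ℝ} (hv : 0 < v) (hR : 0 < R) (a : ℕ → Fin K)
    (x : ℕ → ℝ) (t : ℕ) :
    ∫⁻ l, expWeight R l a x t ∂(mixing K v R) =
      ENNReal.ofReal (√(v ^ K / (gram v a t).det) *
        Real.exp (invGramSq v a x t / (2 * R ^ 2))) := by
  have hw : ∀ k, 0 < v + pulls a t k := fun k => by have := pulls_nonneg a t k; linarith
  have hprod := lintegral_prod_eq_prod_lintegral_of_indepFun (μ := mixing K v R) Finset.univ
    (fun k l => ENNReal.ofReal (Real.exp (l k * armSum a x t k - l k ^ 2 * R ^ 2 * pulls a t k / 2)))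
    (iIndepFun_pi (X := fun k y => ENNReal.ofReal
      (Real.exp (y * armSum a x t k - y ^ 2 * R ^ 2 * pulls a t k / 2)))
      fun k => by fun_prop) (fun k => by fun_prop)
  unfold expWeight
  rw [hprod]
  have hone : ∀ k, ∫⁻ l, ENNReal.ofReal (Real.exp (l k * armSum a x t k -
      l k ^ 2 * R ^ 2 * pulls a t k / 2)) ∂(mixing K v R) =
      ENNReal.ofReal (√(v / (v + pulls a t k)) *
        Real.exp (armSum a x t k ^ 2 / (v + pulls a t k) / (2 * R ^ 2))) := by
    intro k
    have hmp := measurePreserving_eval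
      (fun _ : Fin K => gaussianReal 0 (Real.toNNReal (R ^ 2 * v)⁻¹)) k
    have h1 := hmp.lintegral_comp (f := fun y => ENNReal.ofReal
      (Real.exp (y * armSum a x t k - y ^ 2 * R ^ 2 * pulls a t k / 2))) (by fun_prop)
    refine h1.trans ?_
    -- The prior precision `R ^ 2 * v` makes the posterior precision `R ^ 2 * (v + pulls a t k)`, so
    -- that `R` cancels from the determinant factor.
    have h2 := lintegral_exp_gaussianReal (b := R ^ 2 * v) (c := R ^ 2 * pulls a t k)
      (by positivity) (mul_nonneg (sq_nonneg R) (pulls_nonneg a t k)) (armSum a x t k)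
    simp only [← mul_assoc] at h2
    rw [h2, ← mul_add, mul_div_mul_left _ _ (by positivity), div_div]
    congr 4
    ring
  simp_rw [hone]
  rw [← ENNReal.ofReal_prod_of_nonneg fun k _ => by positivity, Finset.prod_mul_distrib,
    ← Real.exp_sum, ← Finset.sum_div, det_gram, invGramSq]
  congr 2
  rw [← Real.sqrt_prod _ fun k _ => (div_pos hv (hw k)).le, Finset.prod_div_distrib]
  simp

/-! ### Estimation error in the weighted norm -/

lemma wnorm_diagonal {K : ℕ} (w z : Fin K → ℝ) :
    wnorm (diagonal w) z = √(∑ k, w k * z k ^ 2) := by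
  simp only [wnorm, dotProduct, mulVec_diagonal]
  congr 1
  exact Finset.sum_congr rfl fun k _ => by ring

lemma estimate_apply {K d : ℕ} {v : ℝ} (hv : 0 < v) (a : ℕ → Fin K) (c : ℕ → Fin d → ℝ) (t : ℕ)
    (i : Fin d) (k : Fin K) :
    estimate v a c t i k = armSum a (fun s => c s i) t k / (v + pulls a t k) := by
  have hw : ∀ k, v + pulls a t k ≠ 0 := fun k => by have := pulls_nonneg a t k; linarith
  have hinv : (gram v a t)⁻¹ = diagonal fun k => (v + pulls a t k)⁻¹ := by
    rw [gram_eq_diagonal]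
    refine inv_eq_right_inv ?_
    rw [diagonal_mul_diagonal, ← diagonal_one]
    congr 1
    funext k
    exact mul_inv_cancel₀ (hw k)
  rw [estimate, hinv, mulVec_diagonal, Finset.sum_apply, armSum, div_eq_inv_mul]
  congr 1
  refine Finset.sum_congr rfl fun s _ => ?_
  simp [armVec, Pi.single_apply, eq_comm]

lemma mulVec_armVec {K d : ℕ} (A : Matrix (Fin d) (Fin K) ℝ) (k : Fin K) (i : Fin d) :
    (A *ᵥ armVec k) i = A i k := by
  simp [armVec]

lemma armSum_sub {K d : ℕ} (A : Matrix (Fin d) (Fin K) ℝ) (a : ℕ → Fin K) (c : ℕ → Fin d → ℝ)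
    (t : ℕ) (i : Fin d) (k : Fin K) :
    armSum a (fun s => c s i - (A *ᵥ armVec (a s)) i) t k =
      armSum a (fun s => c s i) t k - A i k * pulls a t k := by
  simp only [armSum, pulls, Finset.mul_sum, ← Finset.sum_sub_distrib, mulVec_armVec]
  refine Finset.sum_congr rfl fun s _ => ?_
  split_ifs with h
  · simp [h]
  · simp

lemma sqrt_sum_sub_sq_le {ι : Type*} [Fintype ι] (x y : ι → ℝ) :
    √(∑ k, (x k - y k) ^ 2) ≤ √(∑ k, x k ^ 2) + √(∑ k, y k ^ 2) := by
  have h := norm_sub_le (WithLp.toLp 2 x) (WithLp.toLp 2 y)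
  simpa [EuclideanSpace.norm_eq] using h

/-- The estimation error is bounded by a bias term and the self-normalised noise. -/
lemma wnorm_sub_estimate_le {K d : ℕ} {v : ℝ} (hv : 0 < v) (A : Matrix (Fin d) (Fin K) ℝ)
    (a : ℕ → Fin K) (c : ℕ → Fin d → ℝ) (t : ℕ) (i : Fin d) :
    wnorm (gram v a t) (A i - estimate v a c t i) ≤ √v * ‖WithLp.toLp 2 (A i)‖ +
      √(invGramSq v a (fun s => c s i - (A *ᵥ armVec (a s)) i) t) := by
  have hp := pulls_nonneg a t
  have hw : ∀ k, 0 < v + pulls a t k := fun k => by have := hp k; linarith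
  rw [gram_eq_diagonal, wnorm_diagonal]
  -- Multiplied by its weight `v + pulls a t k`, the error in coordinate `k` is `v * A i k` minus
  -- the summed noise of arm `k`; the triangle inequality separates bias from noise.
  have h := sqrt_sum_sub_sq_le (fun k => v * A i k / √(v + pulls a t k))
    (fun k => armSum a (fun s => c s i - (A *ᵥ armVec (a s)) i) t k / √(v + pulls a t k))
  simp only [← sub_div, div_pow, Real.sq_sqrt (hw _).le] at h
  have heq : ∀ k, (v + pulls a t k) * (A i - estimate v a c t i) k ^ 2 =
      (v * A i k - armSum a (fun s => c s i - (A *ᵥ armVec (a s)) i) t k) ^ 2 /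
        (v + pulls a t k) := by
    intro k
    rw [Pi.sub_apply, estimate_apply hv, armSum_sub]
    have := (hw k).ne'
    field_simp
    ring
  rw [Finset.sum_congr rfl fun k _ => heq k]
  refine h.trans (add_le_add ?_ le_rfl)
  rw [EuclideanSpace.norm_eq, ← Real.sqrt_mul hv.le, Finset.mul_sum]
  refine Real.sqrt_le_sqrt (Finset.sum_le_sum fun k _ => ?_)
  rw [div_le_iff₀ (hw k), Real.norm_eq_abs, sq_abs]
  nlinarith [mul_nonneg (mul_nonneg hv.le (hp k)) (sq_nonneg (A i k))]

lemma pow_le_det_gram {K : ℕ} {v : ℝ} (hv : 0 < v) (a : ℕ → Fin K) (t : ℕ) :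
    v ^ K ≤ (gram v a t).det := by
  rw [det_gram]
  calc v ^ K = ∏ _k : Fin K, v := by simp
    _ ≤ _ := Finset.prod_le_prod (fun _ _ => hv.le) fun k _ => by
      have := pulls_nonneg a t k; linarith

/-- The self-normalised noise is controlled by the mixture of exponential weights. -/
lemma sqrt_invGramSq_le_of_lintegral_lt {K d : ℕ} {v R δ : ℝ} (hv : 0 < v) (hR : 0 < R)
    {a : ℕ → Fin K} {x : ℕ → ℝ} {t : ℕ}
    (h : ∫⁻ l, expWeight R l a x t ∂(mixing K v R) < ENNReal.ofReal (d / δ)) :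
    √(invGramSq v a x t) ≤
      R * √(2 * Real.log (d / δ) + Real.log ((gram v a t).det / v ^ K)) := by
  have hdet : 0 < (gram v a t).det := (pow_pos hv K).trans_le (pow_le_det_gram hv a t)
  have hq : 0 < v ^ K / (gram v a t).det := by positivity
  rw [lintegral_expWeight_mixing hv hR, ENNReal.ofReal_lt_ofReal_iff_of_nonneg (by positivity)] at h
  -- The logarithm of the mixture is the quadratic term over `2 * R ^ 2` minus half of `log (det / v
  -- ^ K)`; clearing `2 * R ^ 2` gives the squared radius.
  have hlog := Real.log_lt_log (by positivity) h
  rw [Real.log_mul (by positivity) (by positivity), Real.log_exp, Real.log_sqrt hq.le,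
    ← inv_div (gram v a t).det, Real.log_inv] at hlog
  rw [← Real.sqrt_sq hR.le, ← Real.sqrt_mul (sq_nonneg R)]
  refine Real.sqrt_le_sqrt ?_
  set Q := invGramSq v a x t
  have hQ : Q = 2 * R ^ 2 * (Q / (2 * R ^ 2)) := by field_simp
  rw [hQ]
  nlinarith [pow_pos hR 2]

/-! ### From confidence sets to feasible sets -/

/-- Every diagonal weight is at least `v > 0`, so the ellipsoid sits in a sup-norm ball of radius `ρ
/ √v` and is compact. -/
lemma exists_isMinOn_dotProduct_ellipsoid {K : ℕ} {v : ℝ} (hv : 0 < v) (a : ℕ → Fin K) (t : ℕ)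
    {ρ : ℝ} (e p : Fin K → ℝ) (hne : ∃ z, wnorm (gram v a t) (z - e) ≤ ρ) :
    ∃ z, wnorm (gram v a t) (z - e) ≤ ρ ∧
      ∀ y, wnorm (gram v a t) (y - e) ≤ ρ → z ⬝ᵥ p ≤ y ⬝ᵥ p := by
  simp only [gram_eq_diagonal, wnorm_diagonal] at hne ⊢
  have hp := pulls_nonneg a t
  have hclosed : IsClosed {z : Fin K → ℝ | √(∑ k, (v + pulls a t k) * (z - e) k ^ 2) ≤ ρ} :=
    isClosed_le (by simp only [Pi.sub_apply]; fun_prop) continuous_const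
  have hsub : {z : Fin K → ℝ | √(∑ k, (v + pulls a t k) * (z - e) k ^ 2) ≤ ρ} ⊆
      Metric.closedBall e (ρ / √v) := by
    intro z (hz : √_ ≤ ρ)
    have hρ : 0 ≤ ρ := (Real.sqrt_nonneg _).trans hz
    rw [Metric.mem_closedBall, dist_pi_le_iff (by positivity)]
    intro k
    rw [le_div_iff₀ (by positivity), mul_comm, Real.dist_eq, ← Real.sqrt_sq_eq_abs,
      ← Real.sqrt_mul hv.le]
    refine le_trans (Real.sqrt_le_sqrt ?_) hz
    calc v * (z k - e k) ^ 2 ≤ (v + pulls a t k) * (z - e) k ^ 2 := by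
          rw [Pi.sub_apply]
          nlinarith [mul_nonneg (hp k) (sq_nonneg (z k - e k))]
      _ ≤ _ := Finset.single_le_sum (f := fun k => (v + pulls a t k) * (z - e) k ^ 2)
          (fun j _ => mul_nonneg (add_nonneg hv.le (hp j)) (sq_nonneg _)) (Finset.mem_univ k)
  have hcomp := (isCompact_closedBall e (ρ / √v)).of_isClosed_subset hclosed hsub
  obtain ⟨z, hz, hmin⟩ := hcomp.exists_isMinOn hne
    (f := fun z => z ⬝ᵥ p) (by unfold dotProduct; fun_prop)
  exact ⟨z, hz, fun y hy => hmin hy⟩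

/-- The rows of a matrix in the confidence set are constrained independently. Row-wise minimisers
therefore assemble into one matrix of the set, which attains the componentwise least value; `A`
itself is a competitor. -/
lemma feasible_subset_pessimistic_of_mem {K d : ℕ} {v : ℝ} (hv : 0 < v)
    {A : Matrix (Fin d) (Fin K) ℝ} {ρ : ℝ} {a : ℕ → Fin K} {c : ℕ → Fin d → ℝ} {t : ℕ}
    (hA : A ∈ confSet v ρ a c t) : feasible A ⊆ pessimistic (confSet v ρ a c t) := by
  rintro p ⟨hp, hAp⟩
  choose z hz hmin using fun i =>
    exists_isMinOn_dotProduct_ellipsoid hv a t (estimate v a c t i) p ⟨A i, hA i⟩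
  refine ⟨hp, Matrix.of z *ᵥ p, ⟨⟨Matrix.of z, hz, rfl⟩, ?_⟩, fun i => ?_⟩
  · rintro _ ⟨B, hB, rfl⟩ i
    exact hmin i _ (hB i)
  · exact (hmin i _ (hA i)).trans (hAp i)

lemma confSet_mono {K d : ℕ} {v ρ ρ' : ℝ} (h : ρ ≤ ρ') (a : ℕ → Fin K) (c : ℕ → Fin d → ℝ)
    (t : ℕ) : confSet v ρ a c t ⊆ confSet v ρ' a c t :=
  fun _ hA i => (hA i).trans h

/-- The factor `1 / 2` bounding `R` enters the root as `1 / 4`, and dividing the determinant by `v ^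
K ≥ 1` only lowers it. Positivity of `d` makes `log (d / δ)` comparable with `log (K / δ)`. -/
lemma radius_le_normalizedRadius {K d : ℕ} {v R S δ : ℝ} (hR : R ≤ 1 / 2)
    (hS : √v * S ≤ 1) (hv : 1 ≤ v) (hd : 0 < d) (hdK : d ≤ K) (hδ : 0 < δ)
    (a : ℕ → Fin K) (t : ℕ) : radius d v R S δ a t ≤ normalizedRadius v δ a t := by
  have hv0 : 0 < v := by linarith
  have hd' : (0 : ℝ) < d := by exact_mod_cast hd
  have hpow : 1 ≤ v ^ K := one_le_pow₀ hv
  have hdet : 0 < (gram v a t).det := (pow_pos hv0 K).trans_le (pow_le_det_gram hv0 a t)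
  refine add_le_add hS ?_
  calc R * √(2 * Real.log (d / δ) + Real.log ((gram v a t).det / v ^ K))
      ≤ 1 / 2 * √(2 * Real.log (K / δ) + Real.log (gram v a t).det) := by
        gcongr
        exact div_le_self hdet.le hpow
    _ = √(1 / 2 * Real.log (K / δ) + 1 / 4 * Real.log (gram v a t).det) := by
        rw [show (1 / 2 : ℝ) * √(2 * Real.log (K / δ) + Real.log (gram v a t).det) =
          √((1 / 2) ^ 2) * √(2 * Real.log (K / δ) + Real.log (gram v a t).det) by
            rw [Real.sqrt_sq (by norm_num)], ← Real.sqrt_mul (by norm_num)]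
        congr 1
        ring

/-! ### Probability that the true matrix escapes -/

section Feedback

variable {Ω : Type*} {mΩ : MeasurableSpace Ω} {P : Measure Ω} [IsProbabilityMeasure P]
  {ℱ : Filtration ℕ mΩ} {K d : ℕ} {A : Matrix (Fin d) (Fin K) ℝ}
  {arm : ℕ → Ω → Fin K} {cost : ℕ → Ω → Fin d → ℝ} {v R S δ : ℝ}

/-- The nonnegative function `exp X + exp (-X) - 2` has integral at most `0` and vanishes only where
`X = 0`. -/
lemma CondSubGaussian.ae_eq_zero {m : MeasurableSpace Ω} (hm : m ≤ mΩ) {X : Ω → ℝ}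
    (hX : CondSubGaussian P m 0 X) : ∀ᵐ ω ∂P, X ω = 0 := by
  have hle : ∀ l : ℝ, ∫ ω, Real.exp (l * X ω) ∂P ≤ 1 := by
    intro l
    rw [← integral_condExp hm]
    refine (integral_mono_ae integrable_condExp (integrable_const (1 : ℝ)) ?_).trans (by simp)
    filter_upwards [(hX l).2] with ω hω
    simpa using hω
  have hnonneg : ∀ ω, 0 ≤ Real.exp (1 * X ω) + Real.exp (-1 * X ω) - 2 := by
    intro ω
    have h1 := Real.add_one_le_exp (1 * X ω)
    have h2 := Real.add_one_le_exp (-1 * X ω)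
    linarith
  have hint : Integrable (fun ω => Real.exp (1 * X ω) + Real.exp (-1 * X ω) - 2) P :=
    ((hX 1).1.add (hX (-1)).1).sub (integrable_const 2)
  have hzero : ∫ ω, (Real.exp (1 * X ω) + Real.exp (-1 * X ω) - 2) ∂P = 0 := by
    refine le_antisymm ?_ (integral_nonneg hnonneg)
    have h1 : ∫ ω, (Real.exp (1 * X ω) + Real.exp (-1 * X ω) - 2) ∂P =
        ∫ ω, (Real.exp (1 * X ω) + Real.exp (-1 * X ω)) ∂P - ∫ _, (2 : ℝ) ∂P :=
      integral_sub ((hX 1).1.add (hX (-1)).1) (integrable_const 2)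
    rw [h1, integral_add (hX 1).1 (hX (-1)).1]
    simp only [integral_const, probReal_univ, smul_eq_mul]
    linarith [hle 1, hle (-1)]
  filter_upwards [(integral_eq_zero_iff_of_nonneg hnonneg hint).1 hzero] with ω hω
  by_contra hne
  have h1 := Real.add_one_lt_exp (x := 1 * X ω) (by simpa using hne)
  have h2 := Real.add_one_le_exp (-1 * X ω)
  simp only [Pi.zero_apply] at hω
  linarith

/-- The true constraint matrix leaves some confidence set with probability at most `δ`. -/
lemma measure_notMem_confSet_le (hv : 0 < v) (hR : 0 ≤ R) (hδ : 0 < δ)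
    (hS : ∀ i, ‖WithLp.toLp 2 (A i)‖ ≤ S) (hfeedback : CostFeedback P ℱ A R arm cost) :
    P {ω | ∃ t, A ∉ confSet v (radius d v R S δ (fun s => arm s ω) t)
      (fun s => arm s ω) (fun s => cost s ω) t} ≤ ENNReal.ofReal δ := by
  set X : Fin d → ℕ → Ω → ℝ := fun i s ω => cost s ω i - (A *ᵥ armVec (arm s ω)) i with hXdef
  have hmem : ∀ ω t, (∀ i, √(invGramSq v (fun s => arm s ω) (fun s => X i s ω) t) ≤
      R * √(2 * Real.log (d / δ) + Real.log ((gram v (fun s => arm s ω) t).det / v ^ K))) →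
      A ∈ confSet v (radius d v R S δ (fun s => arm s ω) t)
        (fun s => arm s ω) (fun s => cost s ω) t := fun ω t h i =>
    (wnorm_sub_estimate_le hv A _ _ t i).trans
      (add_le_add (mul_le_mul_of_nonneg_left (hS i) (Real.sqrt_nonneg v)) (h i))
  -- For `R = 0` the Gaussian prior of variance `(R ^ 2 * v)⁻¹` is not available, but then the noise
  -- vanishes almost surely and only the bias remains.
  rcases hR.eq_or_lt with rfl | hR
  · have hae : ∀ᵐ ω ∂P, ∀ s i, X i s ω = 0 :=
      ae_all_iff.2 fun s => ae_all_iff.2 fun i =>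
        (hfeedback.subGaussian_noise s i).ae_eq_zero (ℱ.le s)
    refine le_of_eq_of_le (measure_mono_null (fun ω => ?_) (ae_iff.1 hae)) bot_le
    rintro ⟨t, ht⟩ hω
    exact ht (hmem ω t fun i => by simp [hω, invGramSq, armSum])
  · have hXm : ∀ i s, Measurable[ℱ (s + 1)] (X i s) := by
      intro i s
      have h1 : Measurable[ℱ (s + 1)] fun ω => cost s ω i :=
        (measurable_pi_apply i).comp (hfeedback.measurable_cost s)
      have h2 : Measurable[ℱ (s + 1)] fun ω => A i (arm s ω) :=
        (measurable_of_countable fun k => A i k).comp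
          ((hfeedback.measurable_arm s).mono (ℱ.mono (Nat.le_succ s)) le_rfl)
      simp only [hXdef, mulVec_armVec]
      exact h1.sub h2
    -- Each row receives a share `δ / d` of the failure probability; the existence of `i` forces `d
    -- > 0`.
    have hrow : ∀ i, P {ω | ∃ t, ENNReal.ofReal (d / δ) ≤
        ∫⁻ l, expWeight R l (fun s => arm s ω) (fun s => X i s ω) t ∂(mixing K v R)} ≤
        ENNReal.ofReal (δ / d) := by
      intro i
      have hd : (0 : ℝ) < d := by exact_mod_cast i.pos
      have h := measure_exists_le_mixture hfeedback.measurable_arm (hXm i)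
        (fun s => hfeedback.subGaussian_noise s i) (mixing K v R) (ENNReal.ofReal (d / δ))
      rw [← inv_div (d : ℝ) δ, ENNReal.ofReal_inv_of_pos (by positivity),
        ENNReal.le_inv_iff_mul_le, mul_comm]
      exact h
    calc _ ≤ P (⋃ i, {ω | ∃ t, ENNReal.ofReal (d / δ) ≤
          ∫⁻ l, expWeight R l (fun s => arm s ω) (fun s => X i s ω) t ∂(mixing K v R)}) := by
          refine measure_mono fun ω => ?_
          rintro ⟨t, ht⟩
          by_contra hω
          simp only [Set.mem_iUnion, Set.mem_ofPred_eq, not_exists, not_le] at hω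
          exact ht (hmem ω t fun i => sqrt_invGramSq_le_of_lintegral_lt hv hR (hω i t))
      _ ≤ ∑ i : Fin d, ENNReal.ofReal (δ / d) :=
          (measure_iUnion_fintype_le P _).trans (Finset.sum_le_sum fun i _ => hrow i)
      _ ≤ ENNReal.ofReal δ := by
          rw [Finset.sum_const, Finset.card_univ, Fintype.card_fin, nsmul_eq_mul,
            ← ENNReal.ofReal_natCast, ← ENNReal.ofReal_mul (Nat.cast_nonneg d)]
          refine ENNReal.ofReal_le_ofReal ?_
          rcases Nat.eq_zero_or_pos d with rfl | hd
          · simpa using hδ.le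
          · rw [mul_div_cancel₀ _ (by positivity)]

end Feedback

end PessimisticFeasible

end

theorem lemma3p1 {Ω : Type*} {mΩ : MeasurableSpace Ω} (P : Measure Ω) [IsProbabilityMeasure P]
    (ℱ : Filtration ℕ mΩ) {K d : ℕ} (A : Matrix (Fin d) (Fin K) ℝ)
    (arm : ℕ → Ω → Fin K) (cost : ℕ → Ω → Fin d → ℝ)
    (v R S δ : ℝ) (hv : 0 < v) (hR : 0 ≤ R) (hδ₀ : 0 < δ) (hδ₁ : δ < 1)
    (hS : ∀ i, ‖WithLp.toLp 2 (A i)‖ ≤ S)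
    (hfeedback : PessimisticFeasible.CostFeedback P ℱ A R arm cost) :
    P {ω | ¬ ∀ t : ℕ, PessimisticFeasible.feasible A ⊆
        PessimisticFeasible.pessimistic
          (PessimisticFeasible.confSet v
            (PessimisticFeasible.radius d v R S δ (fun s => arm s ω) t)
            (fun s => arm s ω) (fun s => cost s ω) t)} ≤ ENNReal.ofReal δ ∧
    (R ≤ 1 / 2 → √v * S ≤ 1 → 1 ≤ v → d ≤ K →
      P {ω | ¬ ∀ t : ℕ, PessimisticFeasible.feasible A ⊆
        PessimisticFeasible.pessimistic
          (PessimisticFeasible.confSet v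
            (PessimisticFeasible.normalizedRadius v δ (fun s => arm s ω) t)
            (fun s => arm s ω) (fun s => cost s ω) t)} ≤ ENNReal.ofReal δ) := by
  have hmain := PessimisticFeasible.measure_notMem_confSet_le hv hR hδ₀ hS hfeedback
  refine ⟨(measure_mono fun ω hω => ?_).trans hmain,
    fun hR' hS' hv' hdK => (measure_mono fun ω hω => ?_).trans hmain⟩
  · by_contra h
    refine hω fun t => PessimisticFeasible.feasible_subset_pessimistic_of_mem hv ?_
    by_contra ht
    exact h ⟨t, ht⟩
  · by_contra h
    refine hω fun t => PessimisticFeasible.feasible_subset_pessimistic_of_mem hv ?_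
    -- With no rows, membership in the confidence set is vacuous. This case is separate because the
    -- comparison of radii needs `d > 0`.
    rcases Nat.eq_zero_or_pos d with rfl | hd
    · exact fun i => i.elim0
    · by_contra ht
      exact h ⟨t, fun h' => ht (PessimisticFeasible.confSet_mono
        (PessimisticFeasible.radius_le_normalizedRadius hR' hS' hv' hd hdK hδ₀ _ t) _ _ t h')⟩
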